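/- Let $d\in\mathbb N$, let $B_d$ be the open unit ball of $\mathbb C^d$, and let $\mathcal H^2_d$ be the Drury–Arveson space, i.e. the reproducing kernel Hilbert space on $B_d$ with kernel $k(x,y)=\frac{1}{1-\langle x,y\rangle}$; write $k_y=k(\cdot,y)$. For $x\in\mathbb C^d$ let $x^n=x^{\otimes n}$ (with $x^0=1$), let $(\mathbb C^d)^n=\mathrm{span}\{x^n:x\in\mathbb C^d\}$, and let $\mathcal F_s(\mathbb C^d)=\bigoplus_{n\ge 0}(\mathbb C^d)^n$ (Hilbert space direct sum) be the symmetric Fock space. For $\xi\in(\mathbb C^d)^n$ let $\langle\cdot,\xi\rangle$ denote the function $x\mapsto\langle x^n,\xi\rangle$ on $B_d$. Every $f\in\mathcal H^2_d$ has a unique expansion $f=\sum_{n\ge0}\langle\cdot,\xi_n\rangle$ with $(\xi_n)_{n\ge 0}\in\mathcal F_s(\mathbb C^d)$; let $J:\mathcal H^2_d\to\mathcal F_s(\mathbb C^d)$, $J(f)=(\xi_n)_{n\ge 0}$, be the resulting anti-unitary map, and let $f_n=\langle\cdot,\xi_n\rangle$ be the $n$-th homogeneous component of $f$. Let $V\subseteq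 B_d$ be a variety, i.e. the common zero set in $B_d$ of a non-empty subset of $\mathcal H^2_d$; call $V$ homogeneous if it is the common zero set in $B_d$ of a set of homogeneous polynomials. Put $$H_V=\overline{\mathrm{span}}\{k_x:x\in V\},\qquad I_V=\{f\in\mathcal H^2_d: f|_V=0\},\qquad J_V=\{f\in\mathcal M_d: f|_V=0\},$$ where $\mathcal M_d=\{f:B_d\to\mathbb C \,:\, fg\in\mathcal H^2_d\text{ for all }g\in\mathcal H^2_d\}$ is the set of multipliers of $\mathcal H^2_d$. Then the following are equivalent: 1. $V$ is homogeneous. 2. $f_n\in J_V$ for all $f\in I_V$ and all $n\ge 0$. 3. $J(H_V)=\bigoplus_{n=0}^{\infty}\mathrm{span}\{x^n:x\in V\}$ (Hilbert space direct sum). 4. $f_n\in H_V$ for all $f\in H_V$ and all $n\ge 0$. 5. $H_V=\overline{\mathrm{span}}\{\langle\cdot,x^n\rangle : x\in V,\ n\ge 0\}$. -/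

import Mathlib

open scoped ComplexOrder ComplexConjugate

noncomputable section

namespace DruryArveson

/- With all of Mathlib imported, `inner ℂ x y` may elaborate through the `CStarModule` structure
of a complex Hilbert space; the instance is switched off in this namespace, so that `inner` is the
inner product of `InnerProductSpace`. -/
attribute [-instance] WithCStarModule.instCStarModuleComplex

/-! ### Tensor powers of `ℂ^d` and the symmetric Fock space

Mathlib's inner product is conjugate-linear in the *first* variable, so that the inner product
`⟨a, b⟩` (linear in `a`) of the mathematical text is `inner ℂ b a`. -/

/-- The Hilbert space `ℂ^d`. -/
abbrev Cd (d : ℕ) : Type := EuclideanSpace ℂ (Fin d)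

/-- The open unit ball `B_d` of `ℂ^d`. -/
abbrev Ball (d : ℕ) : Type := Metric.ball (0 : Cd d) 1

/-- The full `n`-fold Hilbert space tensor power `(ℂ^d)^{⊗n}`, as the space of arrays of
coordinates with respect to the orthonormal basis `e_{i_1} ⊗ ⋯ ⊗ e_{i_n}`.
It is one-dimensional for `n = 0`. -/
abbrev TensorPow (d n : ℕ) : Type := EuclideanSpace ℂ (Fin n → Fin d)

/-- The elementary tensor `x ⊗ ⋯ ⊗ x` (`n` factors); it is the unit `1` for `n = 0`. -/
def tensorPow {d : ℕ} (n : ℕ) (x : Cd d) : TensorPow d n :=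
  WithLp.toLp 2 fun i => ∏ j, x (i j)

/-- The symmetric tensor power `(ℂ^d)^n = span {x^n : x ∈ ℂ^d}`. -/
abbrev SymPow (d n : ℕ) : Submodule ℂ (TensorPow d n) :=
  Submodule.span ℂ (Set.range (tensorPow n))

/-- `x^n` as an element of the symmetric tensor power. -/
def symPow {d : ℕ} (n : ℕ) (x : Cd d) : SymPow d n :=
  ⟨tensorPow n x, Submodule.subset_span ⟨x, rfl⟩⟩

/-- The symmetric Fock space over `ℂ^d`, the Hilbert direct sum of the spaces `(ℂ^d)^n`. -/
abbrev Fock (d : ℕ) : Type := lp (fun n : ℕ => SymPow d n) 2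

theorem inner_tensorPow {d : ℕ} (n : ℕ) (x y : Cd d) :
    inner ℂ (tensorPow n x) (tensorPow n y) = (inner ℂ x y) ^ n := by
  simp only [PiLp.inner_apply, tensorPow, RCLike.inner_apply, map_prod]
  rw [← Fintype.piFinset_univ, ← Finset.card_fin n, ← Finset.prod_const, Finset.card_fin,
    Finset.prod_univ_sum]
  simp only [Finset.prod_mul_distrib]

theorem inner_symPow {d : ℕ} (n : ℕ) (x y : Cd d) :
    inner ℂ (symPow n x) (symPow n y) = (inner ℂ x y) ^ n := by
  simp only [symPow, Submodule.coe_inner]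
  exact inner_tensorPow n x y

theorem norm_symPow {d : ℕ} (n : ℕ) (x : Cd d) : ‖symPow n x‖ = ‖x‖ ^ n := by
  have h := (inner_self_eq_norm_sq_to_K (𝕜 := ℂ) (symPow n x)).symm.trans (inner_symPow n x x)
  rw [inner_self_eq_norm_sq_to_K] at h
  have h2 : ‖symPow n x‖ ^ 2 = (‖x‖ ^ n) ^ 2 := by
    have : ((‖symPow n x‖ ^ 2 : ℝ) : ℂ) = (((‖x‖ ^ n) ^ 2 : ℝ) : ℂ) := by
      push_cast
      rw [← pow_mul, mul_comm n 2, pow_mul]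
      exact h
    exact_mod_cast this
  exact (pow_left_inj₀ (norm_nonneg _) (by positivity) two_ne_zero).1 h2

/-- The vector `(1, x, x^2, …)` of the symmetric Fock space, for `x ∈ B_d`. -/
def geom {d : ℕ} (x : Ball d) : Fock d :=
  ⟨fun n => symPow n (x : Cd d), by
    refine memℓp_gen ?_
    have hx : ‖(x : Cd d)‖ < 1 := mem_ball_zero_iff.1 x.2
    have : Summable fun n : ℕ => (‖(x : Cd d)‖ ^ 2) ^ n :=
      summable_geometric_of_lt_one (by positivity) (by nlinarith [norm_nonneg (x : Cd d)])
    refine this.congr fun n => ?_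
    rw [norm_symPow]
    simp only [ENNReal.toReal_ofNat, Real.rpow_ofNat]
    rw [← pow_mul, ← pow_mul, mul_comm]⟩

theorem inner_geom {d : ℕ} (x y : Ball d) :
    inner ℂ (geom x) (geom y) = 1 / (1 - inner ℂ (x : Cd d) (y : Cd d)) := by
  have hx : ‖(x : Cd d)‖ < 1 := mem_ball_zero_iff.1 x.2
  have hy : ‖(y : Cd d)‖ < 1 := mem_ball_zero_iff.1 y.2
  rw [lp.inner_eq_tsum]
  have : ∀ n, inner ℂ ((geom x : Fock d) n) ((geom y : Fock d) n)
      = (inner ℂ (x : Cd d) (y : Cd d)) ^ n := fun n => inner_symPow n _ _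
  simp only [this]
  rw [tsum_geometric_of_norm_lt_one, one_div]
  refine (norm_inner_le_norm _ _).trans_lt ?_
  nlinarith [norm_nonneg (x : Cd d), norm_nonneg (y : Cd d)]

/-! ### The Drury-Arveson space -/

/-- The kernel `k(x, y) = 1 / (1 - ⟨x, y⟩)` on `B_d`; a scalar is regarded as the operator of
multiplication by it on `ℂ`. -/
def kernel (d : ℕ) : Matrix (Ball d) (Ball d) (ℂ →L[ℂ] ℂ) :=
  Matrix.of fun x y => (1 / (1 - inner ℂ (y : Cd d) (x : Cd d))) • ContinuousLinearMap.id ℂ ℂ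

theorem kernel_apply {d : ℕ} (x y : Ball d) (w : ℂ) :
    kernel d x y w = inner ℂ (geom y) (geom x) * w := by
  simp [kernel, inner_geom]

instance posSemidef_kernel (d : ℕ) : Fact (kernel d).PosSemidef := by
  have hiff := (RKHS.posSemidef_tfae (K := kernel d)).out 0 2
  refine ⟨hiff.2 ⟨?_, fun v => ?_⟩⟩
  · ext x y
    refine ext_inner_right ℂ fun w => ?_
    rw [Matrix.conjTranspose_apply, ContinuousLinearMap.star_eq_adjoint,
      ContinuousLinearMap.adjoint_inner_left, kernel_apply, kernel_apply]
    simp [mul_comm]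
  · have h : (v.sum fun x w => v.sum fun x' w' => inner ℂ (kernel d x' x w) w')
        = inner ℂ (v.sum fun x w => (conj w) • geom x) (v.sum fun x w => (conj w) • geom x) := by
      rw [Finsupp.sum_inner, Finsupp.sum_comm]
      simp only [Finsupp.inner_sum]
      refine Finsupp.sum_congr fun x _ => Finsupp.sum_congr fun y _ => ?_
      rw [kernel_apply]
      refine Eq.trans ?_ (inner_smul_left (𝕜 := ℂ) (geom x) _ _).symm
      refine Eq.trans ?_ (congrArg _ (inner_smul_right (𝕜 := ℂ) (geom x) (geom y) _).symm)
      simp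
      left
      ring
    rw [h]
    exact inner_self_nonneg

/-- The Drury-Arveson space `H²_d`: the reproducing kernel Hilbert space on `B_d` with
kernel `k`. -/
abbrev Space (d : ℕ) : Type := RKHS.OfKernel (kernel d)

/-- The kernel function `k_y(x) = 1 / (1 - ⟨x, y⟩)`. -/
def kerFun {d : ℕ} (y : Ball d) : Space d := RKHS.kerFun (Space d) y 1

theorem kerFun_apply {d : ℕ} (y x : Ball d) :
    kerFun y x = 1 / (1 - inner ℂ (y : Cd d) (x : Cd d)) := by
  rw [kerFun, RKHS.kerFun_apply, RKHS.OfKernel.kernel_ofKernel, kernel_apply, inner_geom, mul_one]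

theorem inner_kerFun_left {d : ℕ} (x : Ball d) (f : Space d) : inner ℂ (kerFun x) f = f x := by
  rw [kerFun, RKHS.kerFun_inner]; simp

theorem inner_geom_eq {d : ℕ} (x y : Ball d) :
    inner ℂ (geom x) (geom y) = inner ℂ (kerFun y) (kerFun x) := by
  rw [inner_kerFun_left, kerFun_apply, inner_geom]

/-- A continuous functional on the Fock space which kills all `(1, x, x^2, …)` is zero. -/
theorem eq_zero_of_inner_geom {d : ℕ} (ξ : Fock d)
    (h : ∀ x : Ball d, inner ℂ ξ (geom x) = 0) : ξ = 0 := by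
  have key : ∀ (x : Ball d) (n : ℕ), inner ℂ (ξ n) (symPow n (x : Cd d)) = 0 := by
    intro x n
    have hx : ‖(x : Cd d)‖ < 1 := mem_ball_zero_iff.1 x.2
    let p : FormalMultilinearSeries ℂ ℂ ℂ := fun n =>
      ContinuousMultilinearMap.mkPiRing ℂ (Fin n) (inner ℂ (ξ n) (symPow n (x : Cd d)))
    have hp : HasFPowerSeriesAt (fun _ : ℂ => (0 : ℂ)) p 0 := by
      rw [hasFPowerSeriesAt_iff]
      filter_upwards [Metric.ball_mem_nhds (0 : ℂ) one_pos] with t ht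
      have ht : ‖t‖ < 1 := mem_ball_zero_iff.1 ht
      have hmem : t • (x : Cd d) ∈ Metric.ball (0 : Cd d) 1 := by
        rw [mem_ball_zero_iff, norm_smul]
        nlinarith [norm_nonneg t, norm_nonneg (x : Cd d)]
      have hs := lp.hasSum_inner (𝕜 := ℂ) ξ (geom ⟨t • (x : Cd d), hmem⟩)
      rw [h] at hs
      convert! hs using 2 with m
      have hsym : symPow m (t • (x : Cd d)) = t ^ m • symPow m (x : Cd d) := by
        ext i
        simp [symPow, tensorPow, Finset.prod_mul_distrib]
      have hco : p.coeff m = inner ℂ (ξ m) (symPow m (x : Cd d)) := by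
        simp [p, FormalMultilinearSeries.coeff]
      change _ = inner ℂ (ξ m) (symPow m (t • (x : Cd d)))
      rw [hsym, hco, smul_eq_mul]
      exact (inner_smul_right (𝕜 := ℂ) (ξ m) (symPow m (x : Cd d)) (t ^ m)).symm
    have h0 := hp.eq_zero
    have h1 : p n = 0 := by rw [h0]; rfl
    have h2 := congrArg (fun q => q (fun _ => (1 : ℂ))) h1
    simpa [p] using h2
  have key' : ∀ (x : Cd d) (n : ℕ), inner ℂ (ξ n) (symPow n x) = 0 := by
    intro x n
    obtain ⟨t, ht0, ht⟩ : ∃ t : ℂ, t ≠ 0 ∧ ‖t • x‖ < 1 := by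
      refine ⟨((1 + ‖x‖)⁻¹ : ℝ), ?_, ?_⟩
      · have : (1 + ‖x‖)⁻¹ ≠ 0 := by positivity
        exact_mod_cast this
      · rw [norm_smul, Complex.norm_real, Real.norm_of_nonneg (by positivity),
          inv_mul_lt_one₀ (by positivity)]
        linarith
    have h1 := key ⟨t • x, mem_ball_zero_iff.2 ht⟩ n
    have hsym : symPow n (t • x) = t ^ n • symPow n x := by
      ext i
      simp [symPow, tensorPow, Finset.prod_mul_distrib]
    change inner ℂ (ξ n) (symPow n (t • x)) = 0 at h1
    rw [hsym] at h1
    have h2 := (inner_smul_right (𝕜 := ℂ) (ξ n) (symPow n x) (t ^ n)).symm.trans h1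
    exact (mul_eq_zero.1 h2).resolve_left (pow_ne_zero n ht0)
  ext1
  funext n
  have hmem : ∀ v ∈ SymPow d n, inner ℂ ((ξ n : SymPow d n) : TensorPow d n) v = 0 := by
    intro v hv
    induction hv using Submodule.span_induction with
    | mem v hv =>
      obtain ⟨x, rfl⟩ := hv
      exact key' x n
    | zero => exact inner_zero_right _
    | add v w _ _ hv hw => rw [inner_add_right, hv, hw, add_zero]
    | smul a v _ hv => rw [inner_smul_right, hv, mul_zero]
  have h0 := hmem _ (ξ n).2
  rw [inner_self_eq_zero] at h0
  exact Subtype.ext h0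

theorem inner_smul_geom {d : ℕ} (a : ℂ) (y : Ball d) (ξ : Fock d) :
    inner ℂ (conj a • geom y) ξ = a * inner ℂ (geom y) ξ :=
  (inner_smul_left (𝕜 := ℂ) (geom y) ξ (conj a)).trans (by rw [Complex.conj_conj])

theorem inner_geom_smul {d : ℕ} (a : ℂ) (y : Ball d) (ξ : Fock d) :
    inner ℂ ξ (a • geom y) = a * inner ℂ ξ (geom y) :=
  inner_smul_right (𝕜 := ℂ) ξ (geom y) a

/-- Linear combinations of kernel functions, as a linear map. -/
def kerComb (d : ℕ) : (Ball d →₀ ℂ) →ₗ[ℂ] Space d := Finsupp.linearCombination ℂ kerFun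

/-- The antilinear map sending `∑ c_y k_y` to `∑ conj(c_y) (1, y, y^2, …)`. -/
def geomComb (d : ℕ) : (Ball d →₀ ℂ) →ₛₗ[starRingEnd ℂ] Fock d where
  toFun c := c.sum fun y a => conj a • geom y
  map_add' a b := by
    rw [Finsupp.sum_add_index'] <;> simp [add_smul]
  map_smul' t a := by
    rw [Finsupp.sum_smul_index] <;> simp [mul_smul, Finsupp.smul_sum]

theorem norm_geomComb {d : ℕ} (c : Ball d →₀ ℂ) : ‖geomComb d c‖ = ‖kerComb d c‖ := by
  have h : inner ℂ (geomComb d c) (geomComb d c) = inner ℂ (kerComb d c) (kerComb d c) := by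
    change inner ℂ (c.sum fun y a => conj a • geom y) (c.sum fun y a => conj a • geom y)
      = inner ℂ (c.sum fun y a => a • kerFun y) (c.sum fun y a => a • kerFun y)
    simp only [Finsupp.sum, sum_inner, inner_sum]
    rw [Finset.sum_comm]
    refine Finset.sum_congr rfl fun x _ => Finset.sum_congr rfl fun y _ => ?_
    rw [inner_smul_geom, inner_geom_smul, inner_geom_eq, inner_smul_left, inner_smul_right]
    ring
  rw [inner_self_eq_norm_sq_to_K, inner_self_eq_norm_sq_to_K] at h
  have h2 : ‖geomComb d c‖ ^ 2 = ‖kerComb d c‖ ^ 2 := by exact_mod_cast h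
  exact (pow_left_inj₀ (norm_nonneg _) (norm_nonneg _) two_ne_zero).1 h2

theorem denseRange_kerComb (d : ℕ) : DenseRange (kerComb d) := by
  have h := RKHS.kerFun_dense (H := Space d)
  have hle : Submodule.span ℂ {f | ∃ x v, RKHS.kerFun (Space d) x v = f}
      ≤ LinearMap.range (kerComb d) := by
    rw [Submodule.span_le]
    rintro _ ⟨x, v, rfl⟩
    refine ⟨Finsupp.single x v, ?_⟩
    rw [kerComb, Finsupp.linearCombination_single, kerFun, ← map_smul, smul_eq_mul, mul_one]
  have h2 := Submodule.topologicalClosure_mono hle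
  rw [h, top_le_iff, ← Submodule.dense_iff_topologicalClosure_eq_top] at h2
  exact h2

/-- The antilinear isometry of `H²_d` into the Fock space with `k_y ↦ (1, y, y^2, …)`. -/
def preJ (d : ℕ) : Space d →ₛₗᵢ[starRingEnd ℂ] Fock d where
  toLinearMap := ((geomComb d).extendOfNorm (kerComb d)).toLinearMap
  norm_map' f := by
    have hn : ∃ C : ℝ, ∀ c, ‖geomComb d c‖ ≤ C * ‖kerComb d c‖ :=
      ⟨1, fun c => by rw [one_mul, norm_geomComb]⟩
    refine (denseRange_kerComb d).induction_on
      (p := fun f => ‖(geomComb d).extendOfNorm (kerComb d) f‖ = ‖f‖) f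
      (isClosed_eq (by fun_prop) (by fun_prop)) fun c => ?_
    rw [LinearMap.extendOfNorm_eq (denseRange_kerComb d) hn, norm_geomComb]

theorem preJ_kerFun {d : ℕ} (y : Ball d) : preJ d (kerFun y) = geom y := by
  have hn : ∃ C : ℝ, ∀ c, ‖geomComb d c‖ ≤ C * ‖kerComb d c‖ :=
    ⟨1, fun c => by rw [one_mul, norm_geomComb]⟩
  have h := LinearMap.extendOfNorm_eq (denseRange_kerComb d) hn (Finsupp.single y 1)
  have h1 : kerComb d (Finsupp.single y 1) = kerFun y := by
    simp [kerComb]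
  have h2 : geomComb d (Finsupp.single y 1) = geom y := by
    simp [geomComb]
  rw [h1, h2] at h
  exact h

theorem inner_preJ {d : ℕ} (f : Space d) (x : Ball d) :
    inner ℂ (preJ d f) (geom x) = f x := by
  refine (denseRange_kerComb d).induction_on
    (p := fun f => inner ℂ (preJ d f) (geom x) = f x) f
    (isClosed_eq ((preJ d).continuous.inner continuous_const) (RKHS.continuous_eval x))
    fun c => ?_
  induction c using Finsupp.induction_linear with
  | zero => simp
  | add a b ha hb => rw [map_add, map_add, inner_add_left, ha, hb, RKHS.coe_add, Pi.add_apply]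
  | single y a =>
    have h : kerComb d (Finsupp.single y a) = a • kerFun y := by simp [kerComb]
    rw [h, (preJ d).map_smulₛₗ, preJ_kerFun, inner_smul_geom, inner_geom_eq, inner_kerFun_left,
      RKHS.coe_smul, Pi.smul_apply, smul_eq_mul]

theorem surjective_preJ (d : ℕ) : Function.Surjective (preJ d) := by
  have hc : IsClosed (Set.range (preJ d)) := (preJ d).isometry.isClosedEmbedding.isClosed_range
  let R : Submodule ℂ (Fock d) := LinearMap.range (preJ d).toLinearMap
  have hR : R.topologicalClosure = ⊤ := by
    refine (Submodule.topologicalClosure_eq_top_iff (𝕜 := ℂ) (E := Fock d) (K := R)).2 ((Submodule.eq_bot_iff _).2 ?_)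
    intro ξ hξ
    refine eq_zero_of_inner_geom ξ fun x => ?_
    have hx : geom x ∈ R := ⟨kerFun x, preJ_kerFun x⟩
    exact Submodule.inner_left_of_mem_orthogonal (𝕜 := ℂ) (E := Fock d) (K := R) hx hξ
  rw [IsClosed.submodule_topologicalClosure_eq (show IsClosed (R : Set (Fock d)) from hc)] at hR
  exact LinearMap.range_eq_top.1 hR

/-- The anti-unitary `J` from `H²_d` onto the symmetric Fock space. It is determined by
`f(x) = ∑ₙ ⟨x^n, (J f)_n⟩` for all `x ∈ B_d`, see `hasSum_J`. -/
def J (d : ℕ) : Space d ≃ₛₗᵢ[starRingEnd ℂ] Fock d :=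
  LinearIsometryEquiv.ofSurjective (preJ d) (surjective_preJ d)

theorem hasSum_J {d : ℕ} (f : Space d) (x : Ball d) :
    HasSum (fun n => inner ℂ (J d f n) (symPow n (x : Cd d))) (f x) := by
  rw [← inner_preJ f x]
  exact lp.hasSum_inner (𝕜 := ℂ) (J d f) (geom x)

/-- `J` is the only map for which the expansion of `hasSum_J` holds. -/
theorem J_unique {d : ℕ} (f : Space d) (ξ : Fock d)
    (h : ∀ x : Ball d, HasSum (fun n => inner ℂ (ξ n) (symPow n (x : Cd d))) (f x)) :
    ξ = J d f := by
  rw [← sub_eq_zero]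
  refine eq_zero_of_inner_geom _ fun x => ?_
  have h1 := (lp.hasSum_inner (𝕜 := ℂ) ξ (geom x)).unique (h x)
  rw [inner_sub_left, h1, sub_eq_zero]
  exact (inner_preJ f x).symm

/-- The homogeneous polynomial function `⟨·, ξ⟩ : x ↦ ⟨x^n, ξ⟩` as an element of `H²_d`, for
`ξ ∈ (ℂ^d)^n`; see `homPoly_apply`. -/
def homPoly {d : ℕ} (n : ℕ) (ξ : SymPow d n) : Space d :=
  (J d).symm (lp.single 2 n ξ)

theorem homPoly_apply {d : ℕ} (n : ℕ) (ξ : SymPow d n) (x : Ball d) :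
    homPoly n ξ x = inner ℂ ξ (symPow n (x : Cd d)) := by
  have h : preJ d (homPoly n ξ) = lp.single 2 n ξ := (J d).apply_symm_apply _
  rw [← inner_preJ, h]
  exact lp.inner_single_left (𝕜 := ℂ) (G := fun n : ℕ => SymPow d n) n ξ (geom x)

/-- The `n`-th homogeneous component `f_n = ⟨·, (J f)_n⟩` of `f`. -/
def homComp {d : ℕ} (n : ℕ) (f : Space d) : Space d := homPoly n (J d f n)

/-! ### Varieties -/

/-- The common zero set `Z(F)` in `B_d` of a set `F ⊆ H²_d`. -/
def zeroLocus {d : ℕ} (F : Set (Space d)) : Set (Ball d) := {x | ∀ f ∈ F, f x = 0}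

/-- A variety in `B_d` is the common zero set of a non-empty subset of `H²_d`. -/
def IsVariety {d : ℕ} (V : Set (Ball d)) : Prop :=
  ∃ F : Set (Space d), F.Nonempty ∧ V = zeroLocus F

/-- `V` is homogeneous if it is the common zero set in `B_d` of a set of homogeneous polynomials
(of possibly different degrees). -/
def IsHomogeneous {d : ℕ} (V : Set (Ball d)) : Prop :=
  ∃ S : Set (MvPolynomial (Fin d) ℂ), (∀ p ∈ S, ∃ n : ℕ, p.IsHomogeneous n) ∧
    V = {x : Ball d | ∀ p ∈ S, MvPolynomial.eval (fun i => (x : Cd d) i) p = 0}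

/-- `H_V`, the closed linear span of the kernel functions `k_x`, `x ∈ V`. -/
def kerSpan {d : ℕ} (V : Set (Ball d)) : Submodule ℂ (Space d) :=
  (Submodule.span ℂ (kerFun '' V)).topologicalClosure

/-- `I_V`, the functions in `H²_d` which vanish on `V`. -/
def vanishing {d : ℕ} (V : Set (Ball d)) : Set (Space d) := {f | ∀ x ∈ V, f x = 0}

/-- The multipliers of `H²_d`: functions `φ` on `B_d` with `φ · H²_d ⊆ H²_d`. -/
def multipliers (d : ℕ) : Set (Ball d → ℂ) :=
  {φ | ∀ g : Space d, ∃ h : Space d, ∀ x, h x = φ x * g x}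

/-- `J_V`, the multipliers of `H²_d` which vanish on `V`. -/
def multVanishing {d : ℕ} (V : Set (Ball d)) : Set (Ball d → ℂ) :=
  {φ | φ ∈ multipliers d ∧ ∀ x ∈ V, φ x = 0}

/-- The Hilbert direct sum `⊕ₙ span {x^n : x ∈ V}` inside the symmetric Fock space (each summand
is finite-dimensional, hence closed). -/
def powSum {d : ℕ} (V : Set (Ball d)) : Set (Fock d) :=
  {ξ | ∀ n, ξ n ∈ Submodule.span ℂ ((fun x : Ball d => symPow n (x : Cd d)) '' V)}

/-- The functions `⟨·, x^n⟩` with `x ∈ V` and `n ≥ 0`. -/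
def powFuns {d : ℕ} (V : Set (Ball d)) : Set (Space d) :=
  {g | ∃ x ∈ V, ∃ n : ℕ, g = homPoly n (symPow n (x : Cd d))}

end DruryArveson

end

/-!
The map `f ↦ f_n` is a bounded projection of `H²_d`, and `f = ∑ f_n` in norm. The value
`f_n(x) = ⟨x^n, (J f)_n⟩` is the inner product of `f` with `⟨·, x^n⟩ = (k_x)_n`
(`inner_homPoly_symPow`), because `J` is anti-unitary. Since `I_V` is the orthogonal complement of
`H_V` (`mem_orthogonal_kerSpan`), it follows that `H_V` is stable under `f ↦ f_n` exactly if all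
components of functions in `I_V` vanish on `V`. These components are homogeneous polynomials, and these
are multipliers because the coordinates are: tensoring with a basis vector and projecting to the
symmetric tensors is a contraction of the Fock space. This links the condition on `I_V` with the
stability of `H_V`.

The geometry enters through dilations. A homogeneous `V` contains `t x` for `x ∈ V` and `|t| < 1`,
so that for `f ∈ I_V` the function `t ↦ f(t x) = ∑ f_n(x) t^n` vanishes identically, and so do its
Taylor coefficients (`IsHomogeneous.homComp_eq_zero`). Conversely, if the components `f_n` of all
`f ∈ I_V` vanish on `V`, then they cut out the variety `V` (`IsVariety.isHomogeneous`).

If `H_V` is stable under `f ↦ f_n`, then it contains all `(k_x)_n = ⟨·, x^n⟩` with `x ∈ V`, and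
`k_x = ∑ (k_x)_n` shows that `H_V` is their closed span. For every `V`, the map `J` takes this closed
span onto `⊕ₙ span {x^n : x ∈ V}` (`image_J_closure_span_powFuns`), and since the latter sum contains
the single components of its elements, `J(H_V)` can be equal to it only if `H_V` is stable.
-/

open scoped ComplexOrder ComplexConjugate

namespace DruryArveson

-- `inner` is to be elaborated through `InnerProductSpace`, not through `CStarModule`.
attribute [-instance] WithCStarModule.instCStarModuleComplex

variable {d : ℕ}

/-! ### Homogeneous components -/

theorem J_apply (f : Space d) : J d f = preJ d f := rfl

theorem J_homPoly (n : ℕ) (ξ : SymPow d n) : J d (homPoly n ξ) = lp.single 2 n ξ :=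
  (J d).apply_symm_apply _

theorem J_kerFun (x : Ball d) : J d (kerFun x) = geom x := preJ_kerFun x

theorem homComp_kerFun (n : ℕ) (x : Ball d) :
    homComp n (kerFun x) = homPoly n (symPow n (x : Cd d)) := by
  rw [homComp, J_kerFun]
  rfl

theorem homComp_apply (n : ℕ) (f : Space d) (x : Ball d) :
    homComp n f x = inner ℂ (J d f n) (symPow n (x : Cd d)) :=
  homPoly_apply _ _ _

theorem homPoly_zero (n : ℕ) : homPoly n (0 : SymPow d n) = 0 := by
  rw [homPoly, lp.single_zero, map_zero]

theorem homPoly_add (n : ℕ) (ξ η : SymPow d n) :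
    homPoly n (ξ + η) = homPoly n ξ + homPoly n η := by
  rw [homPoly, lp.single_add, map_add]; rfl

theorem homPoly_smul (n : ℕ) (a : ℂ) (ξ : SymPow d n) :
    homPoly n (a • ξ) = conj a • homPoly n ξ := by
  rw [homPoly, lp.single_smul, (J d).symm.map_smulₛₗ]; rfl

theorem norm_homComp_le (n : ℕ) (f : Space d) : ‖homComp n f‖ ≤ ‖f‖ := by
  rw [homComp, homPoly, LinearIsometryEquiv.norm_map, lp.norm_single (by norm_num),
    ← (J d).norm_map f]
  exact lp.norm_apply_le_norm (by norm_num) _ _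

/-- The map `f ↦ f_n` as a bounded operator on `H²_d`. -/
noncomputable def homCompCLM (d n : ℕ) : Space d →L[ℂ] Space d :=
  LinearMap.mkContinuous
    { toFun := homComp n
      map_add' := fun f g => by
        rw [homComp, map_add, lp.coeFn_add, Pi.add_apply, homPoly_add]; rfl
      map_smul' := fun a f => by
        rw [homComp, (J d).map_smulₛₗ, lp.coeFn_smul, Pi.smul_apply, homPoly_smul]
        simp [homComp] }
    1 fun f => by rw [one_mul]; exact norm_homComp_le n f

theorem homCompCLM_apply (n : ℕ) (f : Space d) : homCompCLM d n f = homComp n f := rfl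

/-- The homogeneous expansion converges to `f` in the norm of `H²_d`. -/
theorem hasSum_homComp (f : Space d) : HasSum (fun n => homComp n f) f := by
  have h := (lp.hasSum_single (by norm_num) (J d f)).map (J d).symm (J d).symm.continuous
  rwa [(J d).symm_apply_apply] at h

/-- `J` is anti-unitary, by polarization. -/
theorem inner_J (f g : Space d) : inner ℂ (J d f) (J d g) = inner ℂ g f := by
  -- Under the antilinear `J`, multiplication by `i` corresponds to multiplication by `-i`.
  have hI : Complex.I • J d g = J d (-Complex.I • g) := by
    rw [(J d).map_smulₛₗ]
    simp
  have hp : ‖J d f + J d g‖ = ‖g + f‖ := by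
    rw [← map_add, LinearIsometryEquiv.norm_map, add_comm]
  have hm : ‖J d f - J d g‖ = ‖g - f‖ := by
    rw [← map_sub, LinearIsometryEquiv.norm_map, norm_sub_rev]
  -- `f ± i g` has the norm of `g ∓ i f`, from which it differs by a factor `± i`.
  have hIm : ‖J d f - Complex.I • J d g‖ = ‖g - Complex.I • f‖ := by
    have h : f - -Complex.I • g = Complex.I • (g - Complex.I • f) := by
      rw [smul_sub, smul_smul, Complex.I_mul_I]; module
    rw [hI, ← map_sub, LinearIsometryEquiv.norm_map, h, norm_smul, Complex.norm_I, one_mul]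
  have hIp : ‖J d f + Complex.I • J d g‖ = ‖g + Complex.I • f‖ := by
    have h : f + -Complex.I • g = -Complex.I • (g + Complex.I • f) := by
      rw [smul_add, smul_smul, neg_mul, Complex.I_mul_I]; module
    rw [hI, ← map_add, LinearIsometryEquiv.norm_map, h, norm_smul, norm_neg, Complex.norm_I,
      one_mul]
  refine (inner_eq_sum_norm_sq_div_four (𝕜 := ℂ) (J d f) (J d g)).trans ?_
  rw [inner_eq_sum_norm_sq_div_four g f]
  simp only [RCLike.I_to_complex, hp, hm, hIm, hIp]

theorem inner_homPoly (n : ℕ) (ξ : SymPow d n) (g : Space d) :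
    inner ℂ (homPoly n ξ) g = inner ℂ (J d g n) ξ := by
  rw [← inner_J, J_homPoly]
  exact lp.inner_single_right (𝕜 := ℂ) (G := fun n : ℕ => SymPow d n) n ξ (J d g)

/-- The functional `g ↦ g_n(x)` is represented by the function `⟨·, x^n⟩`. -/
theorem inner_homPoly_symPow (n : ℕ) (x : Ball d) (g : Space d) :
    inner ℂ (homPoly n (symPow n (x : Cd d))) g = homComp n g x := by
  rw [inner_homPoly, homComp_apply]

/-! ### Homogeneous polynomials -/

/-- The polynomial whose value at `x` is `⟨x^n, ξ⟩`. -/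
noncomputable def toMvPolynomial (n : ℕ) (ξ : SymPow d n) : MvPolynomial (Fin d) ℂ :=
  ∑ i : Fin n → Fin d, MvPolynomial.C (conj ((ξ : TensorPow d n) i)) * ∏ j, MvPolynomial.X (i j)

theorem isHomogeneous_toMvPolynomial (n : ℕ) (ξ : SymPow d n) :
    (toMvPolynomial n ξ).IsHomogeneous n := by
  refine MvPolynomial.IsHomogeneous.sum _ _ _ fun i _ => ?_
  have h := (MvPolynomial.isHomogeneous_C (Fin d) (conj ((ξ : TensorPow d n) i))).mul
    (MvPolynomial.IsHomogeneous.prod Finset.univ (fun j => MvPolynomial.X (R := ℂ) (i j))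
      (fun _ => 1) fun j _ => MvPolynomial.isHomogeneous_X ℂ (i j))
  simpa using h

theorem eval_toMvPolynomial (n : ℕ) (ξ : SymPow d n) (x : Cd d) :
    MvPolynomial.eval (fun i => x i) (toMvPolynomial n ξ) = inner ℂ ξ (symPow n x) := by
  simp [toMvPolynomial, symPow, tensorPow, PiLp.inner_apply, mul_comm]

/-! ### Homogeneous polynomials are multipliers -/

/-- The tensor `e_a ⊗ ξ`. -/
noncomputable def basisTensor {n : ℕ} (a : Fin d) (ξ : TensorPow d n) : TensorPow d (n + 1) :=
  WithLp.toLp 2 fun i => if i 0 = a then ξ (Fin.tail i) else 0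

theorem norm_basisTensor {n : ℕ} (a : Fin d) (ξ : TensorPow d n) : ‖basisTensor a ξ‖ = ‖ξ‖ := by
  rw [EuclideanSpace.norm_eq, EuclideanSpace.norm_eq]
  congr 1
  rw [← (Fin.consEquiv fun _ : Fin (n + 1) => Fin d).sum_comp, Fintype.sum_prod_type,
    Finset.sum_eq_single a] <;> simp +contextual [basisTensor, Fin.consEquiv]

theorem inner_basisTensor {n : ℕ} (a : Fin d) (ξ : TensorPow d n) (x : Cd d) :
    inner ℂ (basisTensor a ξ) (tensorPow (n + 1) x) = x a * inner ℂ ξ (tensorPow n x) := by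
  rw [PiLp.inner_apply, PiLp.inner_apply, Finset.mul_sum,
    ← (Fin.consEquiv fun _ : Fin (n + 1) => Fin d).sum_comp, Fintype.sum_prod_type,
    Finset.sum_eq_single a]
  · simp [basisTensor, tensorPow, Fin.consEquiv, Fin.prod_univ_succ, mul_assoc]
  · simp +contextual [basisTensor, Fin.consEquiv]
  · simp

/-- The components of the shift of `ξ` by the coordinate `a`: the tensors `e_a ⊗ ξ_n`, projected
to the symmetric tensors. -/
noncomputable def shiftFun (a : Fin d) (ξ : Fock d) : ∀ n, SymPow d n
  | 0 => 0
  | n + 1 => (SymPow d (n + 1)).orthogonalProjectionOnto (basisTensor a (ξ n : TensorPow d n))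

theorem norm_shiftFun_succ_le (a : Fin d) (ξ : Fock d) (n : ℕ) :
    ‖shiftFun a ξ (n + 1)‖ ≤ ‖ξ n‖ :=
  (Submodule.norm_orthogonalProjectionOnto_apply_le (SymPow d (n + 1)) (basisTensor a _)).trans_eq
    (norm_basisTensor a _)

theorem inner_shiftFun_succ (a : Fin d) (ξ : Fock d) (n : ℕ) (x : Cd d) :
    inner ℂ (shiftFun a ξ (n + 1)) (symPow (n + 1) x) = x a * inner ℂ (ξ n) (symPow n x) := by
  rw [Submodule.coe_inner, Submodule.coe_inner]
  refine Eq.trans ?_ (inner_basisTensor a _ x)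
  exact (SymPow d (n + 1)).inner_orthogonalProjectionOnto_eq_of_mem_right (symPow (n + 1) x) _

/-- The shift of `ξ` by the coordinate `a`. -/
noncomputable def shift (a : Fin d) (ξ : Fock d) : Fock d :=
  ⟨shiftFun a ξ, by
    refine memℓp_gen ((summable_nat_add_iff 1).1 ?_)
    refine ((lp.memℓp ξ).summable (by norm_num)).of_nonneg_of_le (fun n => by positivity)
      fun n => ?_
    gcongr
    exact norm_shiftFun_succ_le a ξ n⟩

theorem inner_shift_geom (a : Fin d) (ξ : Fock d) (x : Ball d) :
    inner ℂ (shift a ξ) (geom x) = (x : Cd d) a * inner ℂ ξ (geom x) := by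
  refine (lp.hasSum_inner (𝕜 := ℂ) (shift a ξ) (geom x)).unique ?_
  rw [← hasSum_nat_add_iff' 1]
  have h := (lp.hasSum_inner (𝕜 := ℂ) ξ (geom x)).mul_left ((x : Cd d) a)
  have h0 : inner ℂ ((shift a ξ : Fock d) 0) ((geom x : Fock d) 0) = 0 :=
    inner_zero_left _
  rw [Finset.sum_range_one, h0, sub_zero]
  convert! h using 2 with n
  exact inner_shiftFun_succ a ξ n x

/-- On the Fock space, multiplication by a coordinate is the contraction `shift`. -/
theorem coord_mem_multipliers (a : Fin d) :
    (fun x : Ball d => (x : Cd d) a) ∈ multipliers d := by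
  intro g
  refine ⟨(J d).symm (shift a (J d g)), fun x => ?_⟩
  rw [← inner_preJ, ← inner_preJ g, ← J_apply, ← J_apply, (J d).apply_symm_apply,
    inner_shift_geom]

/-- The multipliers of `H²_d`, as a subalgebra of the functions on `B_d`. -/
def multiplierAlgebra (d : ℕ) : Subalgebra ℂ (Ball d → ℂ) where
  carrier := multipliers d
  mul_mem' {φ ψ} hφ hψ g := by
    obtain ⟨h, hh⟩ := hψ g
    obtain ⟨k, hk⟩ := hφ h
    exact ⟨k, fun x => by rw [hk, hh, Pi.mul_apply, mul_assoc]⟩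
  add_mem' {φ ψ} hφ hψ g := by
    obtain ⟨h, hh⟩ := hψ g
    obtain ⟨k, hk⟩ := hφ g
    exact ⟨k + h, fun x => by rw [RKHS.coe_add, Pi.add_apply, hk, hh, Pi.add_apply, add_mul]⟩
  algebraMap_mem' c g := ⟨c • g, fun x => by rw [RKHS.coe_smul]; rfl⟩

theorem mvPolynomial_mem_multipliers (p : MvPolynomial (Fin d) ℂ) :
    (fun x : Ball d => MvPolynomial.eval (fun i => (x : Cd d) i) p) ∈ multipliers d := by
  change _ ∈ multiplierAlgebra d
  induction p using MvPolynomial.induction_on with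
  | C c =>
    simp only [MvPolynomial.eval_C]
    exact (multiplierAlgebra d).algebraMap_mem c
  | add p q hp hq =>
    simp only [map_add]
    exact (multiplierAlgebra d).add_mem hp hq
  | mul_X p a hp =>
    simp only [map_mul, MvPolynomial.eval_X]
    exact (multiplierAlgebra d).mul_mem hp (coord_mem_multipliers a)

theorem homComp_mem_multipliers (n : ℕ) (f : Space d) :
    (homComp n f : Ball d → ℂ) ∈ multipliers d := by
  convert mvPolynomial_mem_multipliers (toMvPolynomial n (J d f n)) using 1
  ext x
  rw [homComp_apply, eval_toMvPolynomial]

/-! ### Homogeneous varieties -/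

theorem eval_smul_of_isHomogeneous {σ R : Type*} [CommSemiring R] {p : MvPolynomial σ R} {n : ℕ}
    (hp : p.IsHomogeneous n) (t : R) (x : σ → R) :
    MvPolynomial.eval (fun i => t * x i) p = t ^ n * MvPolynomial.eval x p := by
  rw [MvPolynomial.eval_eq, MvPolynomial.eval_eq, Finset.mul_sum]
  refine Finset.sum_congr rfl fun m hm => ?_
  have hdeg := hp (MvPolynomial.mem_support_iff.1 hm)
  rw [← hdeg, Finsupp.weight_apply, Finsupp.sum]
  simp only [mul_pow, Finset.prod_mul_distrib, Finset.prod_pow_eq_pow_sum, Pi.one_apply,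
    smul_eq_mul, mul_one]
  ring

theorem symPow_smul (n : ℕ) (t : ℂ) (x : Cd d) : symPow n (t • x) = t ^ n • symPow n x := by
  ext i
  simp [symPow, tensorPow, Finset.prod_mul_distrib]

/-- A homogeneous variety is invariant under `x ↦ t x`, `|t| < 1`, and the values `f_n(x)` are the
Taylor coefficients at `0` of `t ↦ f(t x)`. -/
theorem IsHomogeneous.homComp_eq_zero {V : Set (Ball d)} (hV : IsHomogeneous V) {f : Space d}
    (hf : f ∈ vanishing V) (n : ℕ) {x : Ball d} (hx : x ∈ V) : homComp n f x = 0 := by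
  obtain ⟨S, hS, rfl⟩ := hV
  -- The series `∑ f_m(x) t^m`, which sums to `f(t x) = 0` for `|t| < 1`.
  let p : FormalMultilinearSeries ℂ ℂ ℂ := fun m =>
    ContinuousMultilinearMap.mkPiRing ℂ (Fin m) (homComp m f x)
  have hp : HasFPowerSeriesAt (fun _ : ℂ => (0 : ℂ)) p 0 := by
    rw [hasFPowerSeriesAt_iff]
    filter_upwards [Metric.ball_mem_nhds (0 : ℂ) one_pos] with t ht
    have ht : ‖t‖ < 1 := mem_ball_zero_iff.1 ht
    have hx1 : ‖(x : Cd d)‖ < 1 := mem_ball_zero_iff.1 x.2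
    have hmem : t • (x : Cd d) ∈ Metric.ball (0 : Cd d) 1 := by
      rw [mem_ball_zero_iff, norm_smul]
      nlinarith [norm_nonneg t, norm_nonneg (x : Cd d)]
    have hs := hasSum_J f ⟨t • (x : Cd d), hmem⟩
    rw [hf _ fun q hq => ?_] at hs
    · convert! hs using 2 with m
      have hco : p.coeff m = homComp m f x := by simp [p, FormalMultilinearSeries.coeff]
      rw [hco, homComp_apply]
      change _ = inner ℂ (J d f m) (symPow m (t • (x : Cd d)))
      rw [symPow_smul, smul_eq_mul]
      exact (inner_smul_right (𝕜 := ℂ) (J d f m) (symPow m (x : Cd d)) (t ^ m)).symm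
    · obtain ⟨m, hm⟩ := hS q hq
      exact (eval_smul_of_isHomogeneous hm t fun i => (x : Cd d) i).trans
        (by rw [hx q hq, mul_zero])
  have h1 : p n = 0 := by rw [hp.eq_zero]; rfl
  have h2 := congrArg (fun q => q fun _ => (1 : ℂ)) h1
  simpa [p] using h2

theorem eq_zero_of_homComp_eq_zero {f : Space d} {x : Ball d} (h : ∀ n, homComp n f x = 0) :
    f x = 0 := by
  refine (hasSum_J f x).unique ?_
  simp only [← homComp_apply, h]
  exact hasSum_zero

theorem IsVariety.eq_zeroLocus_vanishing {V : Set (Ball d)} (hV : IsVariety V) :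
    V = zeroLocus (vanishing V) := by
  obtain ⟨F, -, rfl⟩ := hV
  exact Set.Subset.antisymm (fun x hx f hf => hf x hx) fun x hx f hf => hx f fun y hy => hy f hf

/-- The homogeneous components of the functions in `I_V` are homogeneous polynomials, and if they
vanish on `V`, then they cut it out, since a point at which all `f_n` vanish is a zero of `f`. -/
theorem IsVariety.isHomogeneous {V : Set (Ball d)} (hV : IsVariety V)
    (h : ∀ f ∈ vanishing V, ∀ n, ∀ x ∈ V, homComp n f x = 0) : IsHomogeneous V := by
  refine ⟨{p | ∃ f ∈ vanishing V, ∃ n, p = toMvPolynomial n (J d f n)}, ?_, ?_⟩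
  · rintro _ ⟨f, -, n, rfl⟩
    exact ⟨n, isHomogeneous_toMvPolynomial n _⟩
  · refine Set.Subset.antisymm ?_ fun x hx => ?_
    · rintro x hx _ ⟨f, hf, n, rfl⟩
      rw [eval_toMvPolynomial, ← homComp_apply]
      exact h f hf n x hx
    · rw [hV.eq_zeroLocus_vanishing]
      intro f hf
      refine eq_zero_of_homComp_eq_zero fun n => ?_
      rw [homComp_apply, ← eval_toMvPolynomial]
      exact hx _ ⟨f, hf, n, rfl⟩

/-! ### The subspace `H_V` -/

/-- `I_V` is the orthogonal complement of `H_V`, by the reproducing property. -/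
theorem mem_orthogonal_kerSpan {V : Set (Ball d)} {f : Space d} :
    f ∈ (kerSpan V)ᗮ ↔ f ∈ vanishing V := by
  rw [kerSpan, Submodule.orthogonal_closure]
  constructor
  · intro h x hx
    rw [← inner_kerFun_left]
    exact h _ (Submodule.subset_span ⟨x, hx, rfl⟩)
  · intro h
    rw [Submodule.mem_orthogonal]
    intro u hu
    induction hu using Submodule.span_induction with
    | mem u hu =>
      obtain ⟨x, hx, rfl⟩ := hu
      rw [inner_kerFun_left, h x hx]
    | zero => exact inner_zero_left _
    | add v w _ _ hv hw => rw [inner_add_left, hv, hw, add_zero]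
    | smul a v _ hv => rw [inner_smul_left, hv, mul_zero]

theorem kerFun_mem_kerSpan {V : Set (Ball d)} {x : Ball d} (hx : x ∈ V) : kerFun x ∈ kerSpan V :=
  Submodule.le_topologicalClosure _ (Submodule.subset_span ⟨x, hx, rfl⟩)

/-- A bounded operator maps `closure (span s)` into a closed subspace as soon as it maps `s`
into it. -/
theorem map_mem_of_mem_closure_span {E : Type*} [NormedAddCommGroup E] [NormedSpace ℂ E]
    (T : E →L[ℂ] E) {s : Set E} {K : Submodule ℂ E} (hK : IsClosed (K : Set E))
    (h : ∀ u ∈ s, T u ∈ K) {f : E} (hf : f ∈ (Submodule.span ℂ s).topologicalClosure) :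
    T f ∈ K := by
  have hle : (Submodule.span ℂ s).topologicalClosure ≤ K.comap T.toLinearMap :=
    Submodule.topologicalClosure_minimal _ (Submodule.span_le.2 h) (hK.preimage T.continuous)
  exact hle hf

/-- If `g_n` vanishes on `V` for all `g ∈ I_V`, then `H_V` is stable under `f ↦ f_n`: here
`(k_x)_n = ⟨·, x^n⟩` represents `g ↦ g_n(x)`, hence is orthogonal to `I_V = H_V^⊥`. -/
theorem homComp_mem_kerSpan {V : Set (Ball d)}
    (h : ∀ f ∈ vanishing V, ∀ n, ∀ x ∈ V, homComp n f x = 0) (n : ℕ) {f : Space d}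
    (hf : f ∈ kerSpan V) : homComp n f ∈ kerSpan V := by
  have hcl : IsClosed (kerSpan V : Set (Space d)) := Submodule.isClosed_topologicalClosure _
  refine map_mem_of_mem_closure_span (homCompCLM d n) hcl ?_ hf
  rintro _ ⟨x, hx, rfl⟩
  rw [homCompCLM_apply, homComp_kerFun]
  have : CompleteSpace (kerSpan V) := hcl.completeSpace_coe
  rw [← Submodule.orthogonal_orthogonal (kerSpan V), Submodule.mem_orthogonal']
  intro g hg
  rw [inner_homPoly_symPow]
  exact h g (mem_orthogonal_kerSpan.1 hg) n x hx

theorem homComp_eq_zero_of_homComp_mem_kerSpan {V : Set (Ball d)}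
    (h : ∀ f ∈ kerSpan V, ∀ n, homComp n f ∈ kerSpan V) {f : Space d} (hf : f ∈ vanishing V)
    (n : ℕ) {x : Ball d} (hx : x ∈ V) : homComp n f x = 0 := by
  rw [← inner_homPoly_symPow, ← homComp_kerFun]
  exact mem_orthogonal_kerSpan.2 hf _ (h _ (kerFun_mem_kerSpan hx) n)

theorem kerSpan_eq_closure_span_powFuns {V : Set (Ball d)}
    (h : ∀ f ∈ kerSpan V, ∀ n, homComp n f ∈ kerSpan V) :
    kerSpan V = (Submodule.span ℂ (powFuns V)).topologicalClosure := by
  refine le_antisymm ?_ ?_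
  · refine Submodule.topologicalClosure_minimal _ (Submodule.span_le.2 ?_)
      (Submodule.isClosed_topologicalClosure _)
    rintro _ ⟨x, hx, rfl⟩
    refine (Submodule.isClosed_topologicalClosure _).mem_of_tendsto (hasSum_homComp (kerFun x))
      (Filter.Eventually.of_forall fun s => Submodule.sum_mem _ fun n _ => ?_)
    rw [homComp_kerFun]
    exact Submodule.le_topologicalClosure _ (Submodule.subset_span ⟨x, hx, n, rfl⟩)
  · refine Submodule.topologicalClosure_minimal _ (Submodule.span_le.2 ?_)
      (Submodule.isClosed_topologicalClosure _)
    rintro _ ⟨x, hx, n, rfl⟩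
    rw [← homComp_kerFun]
    exact h _ (kerFun_mem_kerSpan hx) n

theorem homComp_mem_span_powFuns {V : Set (Ball d)} {f : Space d} (hf : J d f ∈ powSum V) (n : ℕ) :
    homComp n f ∈ Submodule.span ℂ (powFuns V) := by
  have hspan : ∀ ξ ∈ Submodule.span ℂ ((fun x : Ball d => symPow n (x : Cd d)) '' V),
      homPoly n ξ ∈ Submodule.span ℂ (powFuns V) := by
    intro ξ hξ
    induction hξ using Submodule.span_induction with
    | mem v hv =>
      obtain ⟨x, hx, rfl⟩ := hv
      exact Submodule.subset_span ⟨x, hx, n, rfl⟩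
    | zero => rw [homPoly_zero]; exact Submodule.zero_mem _
    | add v w _ _ hv hw => rw [homPoly_add]; exact Submodule.add_mem _ hv hw
    | smul a v _ hv => rw [homPoly_smul]; exact Submodule.smul_mem _ _ hv
  exact hspan _ (hf n)

theorem J_apply_mem_span_of_mem_closure {V : Set (Ball d)} {f : Space d}
    (hf : f ∈ (Submodule.span ℂ (powFuns V)).topologicalClosure) (n : ℕ) :
    J d f n ∈ Submodule.span ℂ ((fun x : Ball d => symPow n (x : Cd d)) '' V) := by
  let S := Submodule.span ℂ ((fun x : Ball d => symPow n (x : Cd d)) '' V)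
  let K : Submodule ℂ (Space d) :=
    { carrier := {f | J d f n ∈ S}
      add_mem' := fun {f g} hf hg => by
        rw [Set.mem_ofPred_eq, map_add, lp.coeFn_add, Pi.add_apply]
        exact S.add_mem hf hg
      zero_mem' := by
        rw [Set.mem_ofPred_eq, map_zero]
        exact S.zero_mem
      smul_mem' := fun a f hf => by
        rw [Set.mem_ofPred_eq, (J d).map_smulₛₗ, lp.coeFn_smul, Pi.smul_apply]
        exact S.smul_mem _ hf }
  have hcont : Continuous fun f : Space d => J d f n :=
    (lp.evalCLM ℂ (fun n : ℕ => SymPow d n) 2 n).continuous.comp (J d).continuous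
  have hK : IsClosed (K : Set (Space d)) := S.closed_of_finiteDimensional.preimage hcont
  refine Submodule.topologicalClosure_minimal _ (Submodule.span_le.2 ?_) hK hf
  rintro _ ⟨x, hx, m, rfl⟩
  change J d _ n ∈ S
  rw [J_homPoly]
  by_cases hn : n = m
  · subst hn
    rw [lp.single_apply_self]
    exact Submodule.subset_span ⟨x, hx, rfl⟩
  · rw [lp.single_apply_ne _ _ _ hn]
    exact S.zero_mem

/-- For every `V`, the map `J` takes `closure (span {⟨·, x^n⟩})` onto `⊕ₙ span {x^n}`. -/
theorem image_J_closure_span_powFuns (V : Set (Ball d)) :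
    J d '' ((Submodule.span ℂ (powFuns V)).topologicalClosure : Set (Space d)) = powSum V := by
  refine Set.Subset.antisymm ?_ fun ξ hξ => ?_
  · rintro _ ⟨f, hf, rfl⟩ n
    exact J_apply_mem_span_of_mem_closure hf n
  · obtain ⟨f, rfl⟩ := (J d).surjective ξ
    refine ⟨f, (Submodule.isClosed_topologicalClosure _).mem_of_tendsto (hasSum_homComp f)
      (Filter.Eventually.of_forall fun s => Submodule.sum_mem _ fun n _ =>
        Submodule.le_topologicalClosure _ (homComp_mem_span_powFuns hξ n)), rfl⟩

/-- If `⊕ₙ span {x^n}` contains `ξ`, then it contains each single component `ξ_n`; carried back by `J`,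
this is stability under `f ↦ f_n`. -/
theorem homComp_mem_of_image_J_eq {V : Set (Ball d)}
    {K : Submodule ℂ (Space d)} (h : J d '' (K : Set (Space d)) = powSum V) {f : Space d}
    (hf : f ∈ K) (n : ℕ) : homComp n f ∈ K := by
  have hf' : J d f ∈ powSum V := h ▸ Set.mem_image_of_mem _ hf
  have hmem : J d (homComp n f) ∈ powSum V := by
    intro m
    rw [homComp, J_homPoly]
    by_cases hm : m = n
    · subst hm
      rw [lp.single_apply_self]
      exact hf' m
    · rw [lp.single_apply_ne _ _ _ hm]
      exact Submodule.zero_mem _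
  rw [← h] at hmem
  exact (J d).injective.mem_set_image.1 hmem

end DruryArveson

open DruryArveson in
theorem theorem2p20 {d : ℕ} (V : Set (DruryArveson.Ball d)) (hV : DruryArveson.IsVariety V) :
    List.TFAE [
      DruryArveson.IsHomogeneous V,
      ∀ f ∈ DruryArveson.vanishing V, ∀ n : ℕ,
        (DruryArveson.homComp n f : DruryArveson.Ball d → ℂ) ∈ DruryArveson.multVanishing V,
      DruryArveson.J d '' (DruryArveson.kerSpan V : Set (DruryArveson.Space d))
        = DruryArveson.powSum V,
      ∀ f ∈ DruryArveson.kerSpan V, ∀ n : ℕ, DruryArveson.homComp n f ∈ DruryArveson.kerSpan V,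
      DruryArveson.kerSpan V
        = (Submodule.span ℂ (DruryArveson.powFuns V)).topologicalClosure] := by
  tfae_have 1 → 2 := fun h f hf n =>
    ⟨homComp_mem_multipliers n f, fun x hx => h.homComp_eq_zero hf n hx⟩
  tfae_have 2 → 1 := fun h => hV.isHomogeneous fun f hf n => (h f hf n).2
  tfae_have 2 → 4 := fun h f hf n => homComp_mem_kerSpan (fun g hg m => (h g hg m).2) n hf
  tfae_have 4 → 2 := fun h f hf n =>
    ⟨homComp_mem_multipliers n f, fun x hx => homComp_eq_zero_of_homComp_mem_kerSpan h hf n hx⟩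
  tfae_have 4 → 5 := kerSpan_eq_closure_span_powFuns
  tfae_have 5 → 3 := fun h => by rw [h, image_J_closure_span_powFuns]
  tfae_have 3 → 4 := fun h f hf n => homComp_mem_of_image_J_eq h hf n
  tfae_finish
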